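/- Let $\mathbb N^*=\{1,2,\dots\}$ and let $\bar{\mathbb N}^*=\mathbb N^*\cup\{\infty\}$ be its one-point compactification. Let $\gamma:\mathbb N^*\to(0,\infty)$ satisfy $\sum_{x}\gamma(x)<\infty$, and put $\gamma(\infty)=0$. Let $(N^{(x)}_t)_{t\ge 0}$, $x\in\mathbb N^*$, be i.i.d. Poisson processes of rate $1$, with $\sigma^{(x)}_j$ the $j$-th event time of $N^{(x)}$, and let $T_0$, $T^{(x)}_i$ ($i\ge 1$, $x\in\mathbb N^*$) be i.i.d. exponential random variables of rate $1$, the two families being independent of each other. For $y\in\bar{\mathbb N}^*$ and $c\ge 0$ let $$\Gamma(t)=\Gamma^{c,y}(t)=\gamma(y)T_0+\sum_{x=1}^\infty\gamma(x)\sum_{i=1}^{N^{(x)}_t}T^{(x)}_i+ct,\qquad t\ge 0,$$ and let the $K(\gamma,c)$-process started at $y$ be defined, for $t\ge 0$, by $$\tilde X^{c,y}(t)=\begin{cases}y,&\text{if }0\le t<\gamma(y)T_0,\\ x,&\text{if }\Gamma(\sigma^{(x)}_j-)\le t<\Gamma(\sigma^{(x)}_j)\text{ for some }j\ge 1,\\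 \infty,&\text{otherwise.}\end{cases}$$ Then for every $y\in\bar{\mathbb N}^*$ and every $t>0$, $$\mathbb P(\tilde X^{0,y}(t)=\infty)=0.$$ In particular the $K(\gamma,0)$-process is not strongly continuous at $\infty$: it is not true that $\mathbb P(\tilde X^{0,\infty}(t)=\infty)\to 1$ as $t\downarrow 0$. -/

import Mathlib

open MeasureTheory ProbabilityTheory Filter Topology Set
open scoped NNReal ENNReal

namespace KProc

variable {Ω : Type*}

/-- `N` is a Poisson process of rate `r` under `P`: almost surely its path starts at `0` and is
nondecreasing and right-continuous, and it has independent increments such that `N t - N s` has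
the Poisson law of mean `r * (t - s)` for `s ≤ t`. (The subtraction of naturals is harmless, as the
paths are almost surely nondecreasing.) -/
structure IsPoissonProcess [MeasurableSpace Ω] (N : ℝ≥0 → Ω → ℕ) (r : ℝ≥0) (P : Measure Ω) :
    Prop where
  zero : ∀ᵐ ω ∂P, N 0 ω = 0
  mono : ∀ᵐ ω ∂P, Monotone fun t => N t ω
  rightCts : ∀ᵐ ω ∂P, ∀ t, ContinuousWithinAt (fun u => N u ω) (Ici t) t
  measurable : ∀ t, Measurable (N t)
  indepIncr : HasIndepIncrements N P
  law : ∀ s t, s ≤ t → HasLaw (fun ω => N t ω - N s ω) (poissonMeasure (r * (t - s))) P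

/-- `s` is the `j`-th event time (`j ≥ 1`) of a counting path `n`: the first time at which at least
`j` events have occurred. -/
def IsEventTime (n : ℝ≥0 → ℕ) (j : ℕ) (s : ℝ≥0) : Prop :=
  IsLeast {u | j ≤ n u} s

/-- The extension of `γ` to the one-point compactification by `γ(∞) = 0`. -/
def extend (γ : ℕ+ → ℝ≥0) (y : OnePoint ℕ+) : ℝ≥0 :=
  y.elim 0 γ

/-- The clock `Γ^{c,y}(t) = γ(y) T₀ + ∑_x γ(x) ∑_{i=1}^{N^{(x)}_t} T^{(x)}_i + c t`, with values in
`[0,∞]`. The variable `T^{(x)}_i` of the mathematical notation is `T x (i - 1)`. -/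
noncomputable def clock (γ : ℕ+ → ℝ≥0) (c : ℝ≥0) (N : ℕ+ → ℝ≥0 → Ω → ℕ)
    (T₀ : Ω → ℝ) (T : ℕ+ → ℕ → Ω → ℝ) (y : OnePoint ℕ+) (t : ℝ≥0) (ω : Ω) : ℝ≥0∞ :=
  (extend γ y : ℝ≥0∞) * ENNReal.ofReal (T₀ ω)
    + ∑' x : ℕ+, (γ x : ℝ≥0∞) * ∑ i ∈ Finset.range (N x t ω), ENNReal.ofReal (T x i ω)
    + (c : ℝ≥0∞) * t

/-- At time `t` the process sits at `x`:
`Γ(σ^{(x)}_j -) ≤ t < Γ(σ^{(x)}_j)` for some `j ≥ 1`, where `σ^{(x)}_j` is the `j`-th event time of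
`N^{(x)}` and `Γ(s-)` is the left limit of `Γ` at `s`. -/
def SitsAt (γ : ℕ+ → ℝ≥0) (c : ℝ≥0) (N : ℕ+ → ℝ≥0 → Ω → ℕ)
    (T₀ : Ω → ℝ) (T : ℕ+ → ℕ → Ω → ℝ) (y : OnePoint ℕ+) (t : ℝ≥0) (ω : Ω) (x : ℕ+) : Prop :=
  ∃ j : ℕ, 1 ≤ j ∧ ∃ σ : ℝ≥0, IsEventTime (fun u => N x u ω) j σ ∧
    Function.leftLim (fun u => clock γ c N T₀ T y u ω) σ ≤ t ∧ t < clock γ c N T₀ T y σ ω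

open Classical in
/-- The K-process `X^{c,y}` with parameters `γ` and `c` started at `y`, driven by the Poisson
processes `N` and the exponential variables `T₀, T`. Almost surely at most one `x` satisfies
`SitsAt` at any given time; on the exceptional null event one such `x` is chosen. -/
noncomputable def kProc (γ : ℕ+ → ℝ≥0) (c : ℝ≥0) (N : ℕ+ → ℝ≥0 → Ω → ℕ)
    (T₀ : Ω → ℝ) (T : ℕ+ → ℕ → Ω → ℝ) (y : OnePoint ℕ+) (t : ℝ≥0) (ω : Ω) : OnePoint ℕ+ :=
  if (t : ℝ≥0∞) < (extend γ y : ℝ≥0∞) * ENNReal.ofReal (T₀ ω) then y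
  else if h : ∃ x : ℕ+, SitsAt γ c N T₀ T y t ω x then OnePoint.some h.choose
  else OnePoint.infty

/-- The driving randomness of the K-processes: `N^{(x)}`, `x ≥ 1`, are i.i.d. Poisson processes of
rate 1; `T₀` and `T^{(x)}_i` are i.i.d. exponential variables of rate 1; and the two families are
independent of each other. -/
structure IsDriving [MeasurableSpace Ω] (N : ℕ+ → ℝ≥0 → Ω → ℕ) (T₀ : Ω → ℝ)
    (T : ℕ+ → ℕ → Ω → ℝ) (P : Measure Ω) : Prop where
  poisson : ∀ x, IsPoissonProcess (N x) 1 P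
  indepN : iIndepFun (fun x ω t => N x t ω) P
  measT₀ : Measurable T₀
  measT : ∀ x i, Measurable (T x i)
  lawT₀ : HasLaw T₀ (expMeasure 1) P
  lawT : ∀ x i, HasLaw (T x i) (expMeasure 1) P
  indepT : iIndepFun (fun (k : Option (ℕ+ × ℕ)) => k.elim T₀ fun p => T p.1 p.2) P
  indepNT : IndepFun (fun ω x t => N x t ω)
    (fun ω (k : Option (ℕ+ × ℕ)) => k.elim (T₀ ω) fun p => T p.1 p.2 ω) P

/-- Strong continuity of a family of processes (`Y x` being the one started at `x`) at the pair of
states `(x, y)`: `P(Y^x(t) = y) → δ_{xy}` as `t → 0`, `t > 0`. The family is strongly continuous if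
this holds for all pairs. -/
def StronglyContinuousAt [MeasurableSpace Ω] (P : Measure Ω)
    (Y : OnePoint ℕ+ → ℝ≥0 → Ω → OnePoint ℕ+) (x y : OnePoint ℕ+) : Prop :=
  Tendsto (fun t : ℝ≥0 => P {ω | Y x t ω = y}) (𝓝[>] 0) (𝓝 (Set.indicator {x} 1 y))

end KProc

/-!
The event that the process started at `y` is at `∞` at time `t` is shown to be contained in countably
many null events, each of which is null because a single holding time has a density.

Almost surely the clock is finite (`IsDriving.ae_clock_ne_top`), unbounded
(`IsDriving.ae_exists_lt_clock`), right-continuous, and its initial value differs from `t`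
(`IsDriving.ae_initial_ne`). Let `s` be the first passage time of such a clock over `t`. Either the
clock jumps over `t` at `s`, and then `s` is an event time of some `N x` and the process sits at `x`;
or the clock takes the value `t` at `s`, and approaches it from the right. In the second case some
`N x` has had an event by time `s`, since `t` exceeds the initial value; hence `t` lies in the closure
of the values of the clock at times after the first event of `N x`, which may be taken in a fixed
countable dense set (`exists_jump_or_mem_closure`).

For fixed `x`, this last event is null (`IsDriving.ae_notMem_closure_clock`). After the first event of
`N x` the clock is `γ x * T x 0` plus a residual clock that does not involve `T x 0`. With `c = 0` the
residual clock grows by jumps only, so that the closure of its range is Lebesgue null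
(`volume_closure_image_tsum_indicator`): removing a jump from a monotone path does not decrease the
measure of the closed range, and after the removal of finitely many jumps the range is arbitrarily
short. As `T x 0` is independent of the residual clock and has a density, almost surely
`t - γ x * T x 0` avoids that null set.
-/

namespace KProc

/-! ### The closed range of a pure jump path is Lebesgue null -/

/-- Adding a nonnegative jump to a monotone function does not enlarge the Lebesgue measure of the
closure of its range: the part of the range after the jump is merely translated. -/
theorem volume_closure_image_add_indicator_le {τ : Type*} [LinearOrder τ] {H : τ → ℝ}
    (hH : Monotone H) {A : Set τ} (hA : IsUpperSet A) (w : ℝ) (S : Set τ) :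
    volume (closure ((fun u => H u + A.indicator (fun _ => w) u) '' S)) ≤
      volume (closure (H '' S)) := by
  have himage : (fun u => H u + A.indicator (fun _ => w) u) '' S =
      H '' (S \ A) ∪ (fun r => r + w) '' (H '' (S ∩ A)) := by
    ext r
    constructor
    · rintro ⟨u, hu, rfl⟩
      by_cases h : u ∈ A
      · exact Or.inr ⟨H u, ⟨u, ⟨hu, h⟩, rfl⟩, by simp [h]⟩
      · exact Or.inl ⟨u, ⟨hu, h⟩, by simp [h]⟩
    · rintro (⟨u, ⟨hu, h⟩, rfl⟩ | ⟨_, ⟨u, ⟨hu, h⟩, rfl⟩, rfl⟩)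
      · exact ⟨u, hu, by simp [h]⟩
      · exact ⟨u, hu, by simp [h]⟩
  have hshift : volume (closure ((fun r => r + w) '' (H '' (S ∩ A)))) =
      volume (closure (H '' (S ∩ A))) := by
    have h := (Homeomorph.addRight w).image_closure (H '' (S ∩ A))
    rw [Homeomorph.coe_addRight] at h
    rw [← h, image_add_right, measure_preimage_add_right]
  have hle : volume (closure ((fun u => H u + A.indicator (fun _ => w) u) '' S)) ≤
      volume (closure (H '' (S \ A))) + volume (closure (H '' (S ∩ A))) := by
    rw [himage, closure_union, ← hshift]
    exact measure_union_le _ _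
  refine hle.trans ?_
  rcases (S \ A).eq_empty_or_nonempty with h1 | ⟨u₁, hu₁⟩
  · simp only [h1, image_empty, closure_empty, measure_empty, zero_add]
    exact measure_mono (closure_mono (image_mono inter_subset_left))
  rcases (S ∩ A).eq_empty_or_nonempty with h2 | ⟨u₂, hu₂⟩
  · simp only [h2, image_empty, closure_empty, measure_empty, add_zero]
    exact measure_mono (closure_mono (image_mono sdiff_subset))
  -- The two parts of the range are separated by the level `m`.
  have hsep : ∀ u ∈ S \ A, ∀ v ∈ S ∩ A, H u ≤ H v := fun u hu v hv =>
    hH (le_of_lt (lt_of_not_ge fun h => hu.2 (hA h hv.2)))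
  set m := sSup (H '' (S \ A))
  have hbdd : BddAbove (H '' (S \ A)) := ⟨H u₂, by
    rintro _ ⟨u, hu, rfl⟩; exact hsep u hu u₂ hu₂⟩
  have hlow : closure (H '' (S \ A)) ⊆ closure (H '' S) ∩ Iic m :=
    subset_inter (closure_mono (image_mono sdiff_subset))
      (closure_minimal (fun r hr => le_csSup hbdd hr) isClosed_Iic)
  have hhigh : closure (H '' (S ∩ A)) ⊆ closure (H '' S) ∩ Ici m := by
    refine subset_inter (closure_mono (image_mono inter_subset_left))
      (closure_minimal ?_ isClosed_Ici)
    rintro _ ⟨v, hv, rfl⟩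
    change m ≤ H v
    refine csSup_le ⟨_, u₁, hu₁, rfl⟩ ?_
    rintro _ ⟨u, hu, rfl⟩
    exact hsep u hu v hv
  have hIoi : volume (closure (H '' S) ∩ Ici m) = volume (closure (H '' S) \ Iic m) := by
    rw [sdiff_eq, compl_Iic]
    exact measure_congr ((ae_eq_refl _).inter Ioi_ae_eq_Ici.symm)
  calc volume (closure (H '' (S \ A))) + volume (closure (H '' (S ∩ A)))
      ≤ volume (closure (H '' S) ∩ Iic m) + volume (closure (H '' S) \ Iic m) := by
        rw [← hIoi]
        exact add_le_add (measure_mono hlow) (measure_mono hhigh)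
    _ = volume (closure (H '' S)) := measure_inter_add_sdiff _ measurableSet_Iic

/-- The closure of the range of a function that increases only by summably many jumps is
Lebesgue null. -/
theorem volume_closure_image_tsum_indicator {τ κ : Type*} [LinearOrder τ] (a : ℝ) {w : κ → ℝ}
    (hw : ∀ k, 0 ≤ w k) (hsum : Summable w) {A : κ → Set τ} (hA : ∀ k, IsUpperSet (A k))
    (S : Set τ) :
    volume (closure ((fun u => a + ∑' k, (A k).indicator (fun _ => w k) u) '' S)) = 0 := by
  have hnonneg : ∀ k u, 0 ≤ (A k).indicator (fun _ => w k) u := fun k u =>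
    indicator_nonneg (fun _ _ => hw k) u
  have hle : ∀ k u, (A k).indicator (fun _ => w k) u ≤ w k := fun k u =>
    indicator_le_self' (fun _ _ => hw k) u
  have hmono : ∀ k, Monotone ((A k).indicator fun _ => w k) := by
    intro k u v huv
    by_cases hu : u ∈ A k
    · simp [hu, hA k huv hu]
    · simpa [hu] using hnonneg k v
  have hsumu : ∀ u, Summable fun k => (A k).indicator (fun _ => w k) u := fun u =>
    Summable.of_nonneg_of_le (fun k => hnonneg k u) (fun k => hle k u) hsum
  -- Finitely many jumps can be removed.
  have hfin : ∀ (K : Finset κ) (H : τ → ℝ), Monotone H →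
      volume (closure ((fun u => H u + ∑ k ∈ K, (A k).indicator (fun _ => w k) u) '' S)) ≤
        volume (closure (H '' S)) := by
    classical
    intro K
    induction K using Finset.induction_on with
    | empty => intro H _; simp
    | insert k K hk ih =>
      intro H hH
      refine le_trans ?_ (ih H hH)
      have hH' : Monotone fun u => H u + ∑ k ∈ K, (A k).indicator (fun _ => w k) u :=
        hH.add (fun u v huv => Finset.sum_le_sum fun k _ => hmono k huv)
      refine le_trans (le_of_eq ?_) (volume_closure_image_add_indicator_le hH' (hA k) (w k) S)
      congr 3
      funext u
      rw [Finset.sum_insert hk]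
      ring
  -- The remaining jumps have small total size, which bounds the range.
  refine le_antisymm (ENNReal.le_of_forall_pos_le_add fun ε hε _ => ?_) zero_le
  have htail : ∀ᶠ K : Finset κ in atTop, ∑' k : {k // k ∉ K}, w k < ε :=
    (tendsto_tsum_compl_atTop_zero w).eventually (gt_mem_nhds (by exact_mod_cast hε))
  obtain ⟨K, hK⟩ := htail.exists
  set H : τ → ℝ := fun u => a + ∑' k : {k // k ∉ K}, (A k).indicator (fun _ => w k) u with hHdef
  have hsub : ∀ u, Summable fun k : {k // k ∉ K} => (A k).indicator (fun _ => w k) u := fun u =>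
    (hsumu u).subtype _
  have hHmono : Monotone H := fun u v huv =>
    add_le_add le_rfl ((hsub u).tsum_le_tsum (fun k => hmono k huv) (hsub v))
  have hdecomp : (fun u => a + ∑' k, (A k).indicator (fun _ => w k) u) =
      fun u => H u + ∑ k ∈ K, (A k).indicator (fun _ => w k) u := by
    funext u
    have h := (hsumu u).sum_add_tsum_subtype_compl K
    simp only [hHdef]
    linarith
  have hrange : closure (H '' S) ⊆ Icc a (a + ε) := by
    refine closure_minimal ?_ isClosed_Icc
    rintro _ ⟨u, _, rfl⟩
    have h1 : 0 ≤ ∑' k : {k // k ∉ K}, (A k).indicator (fun _ => w k) u :=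
      tsum_nonneg fun k => hnonneg k u
    have h2 : ∑' k : {k // k ∉ K}, (A k).indicator (fun _ => w k) u ≤ ∑' k : {k // k ∉ K}, w k :=
      (hsub u).tsum_le_tsum (fun k => hle k u) (hsum.subtype _)
    exact ⟨by simp only [hHdef]; linarith, by simp only [hHdef]; linarith⟩
  calc volume (closure ((fun u => a + ∑' k, (A k).indicator (fun _ => w k) u) '' S))
      ≤ volume (closure (H '' S)) := by rw [hdecomp]; exact hfin K H hHmono
    _ ≤ volume (Icc a (a + ε)) := measure_mono hrange
    _ = 0 + ε := by simp

/-! ### Deterministic clocks -/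

/-- The clock with `c = 0` as a function of the data of one sample point: the initial value `a`, the
counting paths `n` and the `[0,∞]`-valued holding times `w`. -/
noncomputable def pathClock (γ : ℕ+ → ℝ≥0) (a : ℝ≥0∞) (n : ℕ+ → ℝ≥0 → ℕ) (w : ℕ+ → ℕ → ℝ≥0∞)
    (u : ℝ≥0) : ℝ≥0∞ :=
  a + ∑' x, (γ x : ℝ≥0∞) * ∑ i ∈ Finset.range (n x u), w x i

theorem clock_zero_eq_pathClock {Ω : Type*} (γ : ℕ+ → ℝ≥0) (N : ℕ+ → ℝ≥0 → Ω → ℕ) (T₀ : Ω → ℝ)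
    (T : ℕ+ → ℕ → Ω → ℝ) (y : OnePoint ℕ+) (u : ℝ≥0) (ω : Ω) :
    clock γ 0 N T₀ T y u ω = pathClock γ (extend γ y * ENNReal.ofReal (T₀ ω))
      (fun x t => N x t ω) (fun x i => ENNReal.ofReal (T x i ω)) u := by
  simp [clock, pathClock]

section PathClock

variable {γ : ℕ+ → ℝ≥0} {a : ℝ≥0∞} {n : ℕ+ → ℝ≥0 → ℕ} {w : ℕ+ → ℕ → ℝ≥0∞}

theorem pathClock_mono (hn : ∀ x, Monotone (n x)) : Monotone (pathClock γ a n w) :=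
  fun _ _ huv => add_le_add le_rfl (ENNReal.tsum_le_tsum fun x => mul_le_mul_right
    (Finset.sum_le_sum_of_subset (Finset.range_subset_range.2 (hn x huv))) _)

/-- If each counting path has settled at its value at `s` along a filter `l`, then so has, in the
limit, the clock. -/
theorem tendsto_pathClock {l : Filter ℝ≥0} [l.IsCountablyGenerated] {s U : ℝ≥0}
    (hn : ∀ x, Monotone (n x)) (hfin : pathClock γ a n w U ≠ ∞) (hlU : ∀ᶠ u in l, u ≤ U)
    (hl : ∀ x, ∀ᶠ u in l, n x u = n x s) :
    Tendsto (pathClock γ a n w) l (𝓝 (pathClock γ a n w s)) := by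
  refine Tendsto.const_add _ ?_
  let _ : MeasurableSpace ℕ+ := ⊤
  simp only [← lintegral_count]
  refine tendsto_lintegral_filter_of_dominated_convergence
    (fun x => (γ x : ℝ≥0∞) * ∑ i ∈ Finset.range (n x U), w x i)
    (Eventually.of_forall fun _ => measurable_from_top) ?_ ?_ ?_
  · filter_upwards [hlU] with u hu
    exact Eventually.of_forall fun x => mul_le_mul_right
      (Finset.sum_le_sum_of_subset (Finset.range_subset_range.2 (hn x hu))) _
  · rw [lintegral_count]
    exact fun h => hfin (by simp [pathClock, h])
  · refine Eventually.of_forall fun x => tendsto_const_nhds.congr' ?_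
    filter_upwards [hl x] with u hu
    rw [hu]

/-- The clock as a sum over the individual jumps. -/
theorem pathClock_eq_tsum_indicator (hn : ∀ x, Monotone (n x)) {u U : ℝ≥0} (hu : u ≤ U) :
    pathClock γ a n w u = a + ∑' k : ℕ+ × ℕ, {v | k.2 < n k.1 v}.indicator
      (fun _ => if k.2 < n k.1 U then (γ k.1 : ℝ≥0∞) * w k.1 k.2 else 0) u := by
  rw [pathClock, ENNReal.tsum_prod']
  congr 1
  refine tsum_congr fun x => ?_
  rw [Finset.mul_sum, tsum_eq_sum (s := Finset.range (n x u))]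
  · refine Finset.sum_congr rfl fun i hi => ?_
    have h1 : i < n x u := Finset.mem_range.1 hi
    simp [h1, h1.trans_le (hn x hu)]
  · intro i hi
    have h1 : ¬ i < n x u := fun h => hi (Finset.mem_range.2 h)
    simp [h1]

/-- On a time interval where it is finite, the clock has a Lebesgue null closed range. -/
theorem volume_closure_image_pathClock (hn : ∀ x, Monotone (n x)) {U : ℝ≥0}
    (hfin : pathClock γ a n w U ≠ ∞) {S : Set ℝ≥0} (hS : ∀ u ∈ S, u ≤ U) :
    volume (closure ((fun u => (pathClock γ a n w u).toReal) '' S)) = 0 := by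
  set v : ℕ+ × ℕ → ℝ≥0∞ :=
    fun k => if k.2 < n k.1 U then (γ k.1 : ℝ≥0∞) * w k.1 k.2 else 0 with hv
  have hU : pathClock γ a n w U = a + ∑' k, v k := by
    rw [pathClock_eq_tsum_indicator hn le_rfl]
    congr 1
    refine tsum_congr fun k => ?_
    by_cases h : k.2 < n k.1 U <;> simp [hv, h]
  rw [hU] at hfin
  have ha : a ≠ ∞ := fun h => hfin (by simp [h])
  have hvsum : ∑' k, v k ≠ ∞ := fun h => hfin (by simp [h])
  have hvtop : ∀ k, v k ≠ ∞ := ENNReal.ne_top_of_tsum_ne_top hvsum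
  have heq : (fun u => (pathClock γ a n w u).toReal) '' S = (fun u => a.toReal +
      ∑' k : ℕ+ × ℕ, {t | k.2 < n k.1 t}.indicator (fun _ => (v k).toReal) u) '' S := by
    refine image_congr fun u hu => ?_
    have hle : ∀ k : ℕ+ × ℕ, {t | k.2 < n k.1 t}.indicator (fun _ => v k) u ≤ v k := fun k =>
      indicator_le_self _ _ _
    rw [pathClock_eq_tsum_indicator hn (hS u hu), ENNReal.toReal_add ha
      (ne_top_of_le_ne_top hvsum (ENNReal.tsum_le_tsum hle)),
      ENNReal.tsum_toReal_eq fun k => ne_top_of_le_ne_top (hvtop k) (hle k)]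
    congr 1
    refine tsum_congr fun k => ?_
    by_cases h : k.2 < n k.1 u <;> simp [h, hv]
  rw [heq]
  exact volume_closure_image_tsum_indicator _ (fun _ => ENNReal.toReal_nonneg)
    (ENNReal.summable_toReal hvsum) (A := fun k => {t | k.2 < n k.1 t})
    (fun k s t hst hs => lt_of_lt_of_le hs (hn k.1 hst)) S

/-- A time `t`, past the initial value of the clock and before some value of the clock, is either
covered by a jump of the clock at an event time of some `n x`, or a limit of values of the clock at
times of a dense sequence `q` at which one of the counting paths, say `n x`, has already jumped. -/
theorem exists_jump_or_mem_closure (hn : ∀ x, Monotone (n x)) (hn0 : ∀ x, n x 0 = 0)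
    (hrc : ∀ x s, ContinuousWithinAt (n x) (Ici s) s) (hfin : ∀ u, pathClock γ a n w u ≠ ∞)
    {t : ℝ≥0} (hat : a < t) {b : ℝ≥0} (hb : t < pathClock γ a n w b) {q : ℕ → ℝ≥0}
    (hq : DenseRange q) :
    (∃ x j, 1 ≤ j ∧ ∃ s, IsEventTime (n x) j s ∧
      Function.leftLim (pathClock γ a n w) s ≤ t ∧ t < pathClock γ a n w s) ∨
    ∃ (x : ℕ+) (U : ℕ), (t : ℝ) ∈
      closure ((fun u => (pathClock γ a n w u).toReal) '' {u | u ∈ range q ∧ u ≤ U ∧ 0 < n x u}) := by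
  set F := pathClock γ a n w with hF
  have hFmono : Monotone F := pathClock_mono hn
  have hF0 : F 0 = a := by simp [hF, pathClock, hn0]
  set s := sInf {u | (t : ℝ≥0∞) < F u} with hs
  have hbelow : ∀ u < s, F u ≤ t := fun u hu => not_lt.1 fun h => notMem_of_lt_csInf hu
    (OrderBot.bddBelow _) h
  have habove : ∀ u, s < u → (t : ℝ≥0∞) < F u := by
    intro u hu
    obtain ⟨v, hv, hvu⟩ := (csInf_lt_iff (OrderBot.bddBelow _) ⟨b, hb⟩).1 hu
    exact lt_of_lt_of_le hv (hFmono hvu.le)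
  -- The clock is right-continuous
  have hright : Tendsto F (𝓝[>] s) (𝓝 (F s)) := by
    refine tendsto_pathClock (U := s + 1) hn (hfin _) ?_ fun x => ?_
    · exact nhdsWithin_le_nhds (Iic_mem_nhds (by simp))
    · have h := ((hrc x s).mono Ioi_subset_Ici_self).tendsto
      rw [nhds_discrete] at h
      exact tendsto_pure.1 h
  have hts : (t : ℝ≥0∞) ≤ F s :=
    ge_of_tendsto hright (eventually_nhdsWithin_of_forall fun u hu => (habove u hu).le)
  rcases hts.lt_or_eq with hlt | heq
  · -- The clock passes over `t` by a jump at its first passage time `s`.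
    left
    have hs0 : s ≠ 0 := fun h => absurd hat (not_lt.2 (by rw [← hF0, ← h]; exact hlt.le))
    have : (𝓝[<] s).NeBot := nhdsLT_neBot_of_exists_lt ⟨0, pos_iff_ne_zero.2 hs0⟩
    have hleft : Function.leftLim F s ≤ t := by
      rw [hFmono.leftLim_eq_sSup]
      refine sSup_le ?_
      rintro _ ⟨u, hu, rfl⟩
      exact hbelow u hu
    have hjump : ∃ x, ∀ u < s, n x u < n x s := by
      by_contra! hcon
      refine absurd hlt (not_lt.2 (le_of_tendsto (f := F) (x := 𝓝[<] s) ?_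
        (eventually_nhdsWithin_of_forall hbelow)))
      refine tendsto_pathClock (U := s) hn (hfin _)
        (eventually_nhdsWithin_of_forall fun u hu => le_of_lt hu) fun x => ?_
      obtain ⟨v, hv, hvs⟩ := hcon x
      filter_upwards [Ioo_mem_nhdsLT hv] with u hu
      exact le_antisymm (hn x hu.2.le) (hvs.trans (hn x hu.1.le))
    obtain ⟨x, hx⟩ := hjump
    exact ⟨x, n x s, (Nat.zero_le _).trans_lt (hx 0 (pos_iff_ne_zero.2 hs0)), s,
      ⟨le_refl (n x s), fun u hu => not_lt.1 fun h => absurd (hx u h) (not_lt.2 hu)⟩, hleft, hlt⟩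
  · -- The clock equals `t` at time `s`, and its values at later times decrease to `t`.
    right
    have hx : ∃ x, 0 < n x s := by
      by_contra! hcon
      have : F s = a := by simp [hF, pathClock, fun x => Nat.le_zero.1 (hcon x)]
      exact hat.ne (by rw [← this, heq])
    obtain ⟨x, hx⟩ := hx
    obtain ⟨U, hU⟩ := exists_nat_gt s
    refine ⟨x, U, ?_⟩
    have hreal : Tendsto (fun u => (F u).toReal) (𝓝[>] s) (𝓝 (t : ℝ)) := by
      rw [← heq] at hright
      exact (ENNReal.tendsto_toReal ENNReal.coe_ne_top).comp hright
    rw [mem_closure_iff_nhds]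
    intro V hV
    have hev : ∀ᶠ u in 𝓝[>] s, (F u).toReal ∈ V := hreal hV
    obtain ⟨r, hr, hrV⟩ := (mem_nhdsGT_iff_exists_Ioo_subset' (u' := s + 1) (by simp)).1 hev
    obtain ⟨k, hu1, hu2⟩ := hq.exists_mem_open (isOpen_Ioo (a := s) (b := min r U))
      (nonempty_Ioo.2 (lt_min hr hU))
    exact ⟨_, hrV ⟨hu1, hu2.trans_le (min_le_left _ _)⟩, q k, ⟨⟨k, rfl⟩,
      (hu2.trans_le (min_le_right _ _)).le, hx.trans_le (hn x hu1.le)⟩, rfl⟩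

end PathClock

/-! ### Exponential and Poisson laws -/

theorem expMeasure_one_absolutelyContinuous : expMeasure 1 ≪ volume :=
  withDensity_absolutelyContinuous _ _

theorem ae_nonneg_expMeasure_one : ∀ᵐ r ∂expMeasure 1, 0 ≤ r := by
  rw [ae_iff]
  have h : {r : ℝ | ¬ 0 ≤ r} = Iio 0 := by ext; simp
  rw [h, expMeasure, gammaMeasure, withDensity_apply _ measurableSet_Iio]
  exact lintegral_gammaPDF_of_nonpos le_rfl

theorem expMeasure_one_Ioi_one_ne_zero : expMeasure 1 (Ioi 1) ≠ 0 := by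
  have := isProbabilityMeasure_expMeasure one_pos
  rw [← compl_Iic, Ne, prob_compl_eq_zero_iff measurableSet_Iic]
  intro h
  have h1 := cdf_eq_real (expMeasure 1) 1
  rw [measureReal_def, h, cdf_expMeasure_eq one_pos] at h1
  simp at h1

theorem lintegral_ofReal_expMeasure_one_ne_top :
    ∫⁻ r, ENNReal.ofReal r ∂expMeasure 1 ≠ ∞ := by
  have hm : ∀ r, Measurable (exponentialPDF r) := fun r =>
    (measurable_exponentialPDFReal r).ennreal_ofReal
  have h : ∫⁻ r, ENNReal.ofReal r ∂expMeasure 1 =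
      ∫⁻ r, exponentialPDF 1 r * ENNReal.ofReal r :=
    lintegral_withDensity_eq_lintegral_mul _ (hm 1) ENNReal.measurable_ofReal
  -- the linear factor is absorbed by half of the exponential decay
  have hle : ∀ r, exponentialPDF 1 r * ENNReal.ofReal r ≤
      ENNReal.ofReal 4 * exponentialPDF (1 / 2) r := by
    intro r
    rcases lt_or_ge r 0 with hr | hr
    · simp [exponentialPDF_of_neg hr]
    · rw [exponentialPDF_of_nonneg hr, exponentialPDF_of_nonneg hr,
        ← ENNReal.ofReal_mul (by positivity), ← ENNReal.ofReal_mul (by norm_num)]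
      refine ENNReal.ofReal_le_ofReal ?_
      have h1 : Real.exp (-(1 * r)) = Real.exp (-(1 / 2 * r)) * Real.exp (-(1 / 2 * r)) := by
        rw [← Real.exp_add]; ring_nf
      have h2 : Real.exp (-(1 / 2 * r)) * Real.exp (1 / 2 * r) = 1 := by
        rw [← Real.exp_add]; simp
      have h3 := Real.add_one_le_exp (1 / 2 * r)
      have h4 := Real.exp_pos (-(1 / 2 * r))
      have h5 : Real.exp (-(1 / 2 * r)) * r ≤ 2 := by nlinarith
      rw [h1]
      nlinarith
  refine ne_top_of_le_ne_top ?_ (h.le.trans (lintegral_mono hle))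
  rw [lintegral_const_mul _ (hm _), lintegral_exponentialPDF_eq_one (by norm_num)]
  simp

theorem lintegral_natCast_poissonMeasure_ne_top (r : ℝ≥0) :
    ∫⁻ k : ℕ, (k : ℝ≥0∞) ∂poissonMeasure r ≠ ∞ := by
  rw [lintegral_countable']
  have hle : ∀ k : ℕ, (k : ℝ≥0∞) * poissonMeasure r {k} ≤
      ENNReal.ofReal ((2 * r : ℝ) ^ k / k.factorial) := by
    intro k
    rw [poissonMeasure_singleton, ← ENNReal.ofReal_natCast, ← ENNReal.ofReal_mul (by positivity)]
    refine ENNReal.ofReal_le_ofReal ?_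
    have h1 : (k : ℝ) ≤ 2 ^ k := by exact_mod_cast Nat.lt_two_pow_self.le
    have h2 : Real.exp (-(r : ℝ)) ≤ 1 := Real.exp_le_one_iff.2 (by simp)
    calc (k : ℝ) * (Real.exp (-r) * r ^ k / k.factorial)
        ≤ 2 ^ k * (1 * r ^ k / k.factorial) := by gcongr
      _ = (2 * r : ℝ) ^ k / k.factorial := by rw [mul_pow]; ring
  refine ne_top_of_le_ne_top ?_ (ENNReal.tsum_le_tsum hle)
  rw [← ENNReal.ofReal_tsum_of_nonneg (fun k => by positivity)
    (Real.summable_pow_div_factorial _)]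
  exact ENNReal.ofReal_ne_top

theorem tendsto_poissonMeasure_natCast_Iic (k : ℕ) :
    Tendsto (fun m : ℕ => poissonMeasure (m : ℝ≥0) (Iic k)) atTop (𝓝 0) := by
  have hfin : ∀ m : ℕ, poissonMeasure (m : ℝ≥0) (Iic k) =
      ∑ i ∈ Finset.Iic k, poissonMeasure (m : ℝ≥0) {i} := by
    intro m
    rw [sum_measure_singleton, Finset.coe_Iic]
  simp only [hfin, poissonMeasure_singleton]
  rw [← Finset.sum_const_zero (s := Finset.Iic k) (M := ℝ≥0∞)]
  refine tendsto_finsetSum _ fun i _ => ?_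
  have h : Tendsto (fun m : ℕ => (m : ℝ) ^ i * Real.exp (-(m : ℝ)) / i.factorial) atTop
      (𝓝 (0 / i.factorial)) :=
    ((Real.tendsto_pow_mul_exp_neg_atTop_nhds_zero i).comp
      tendsto_natCast_atTop_atTop).div_const _
  rw [zero_div] at h
  simpa [mul_comm] using ENNReal.tendsto_ofReal h

theorem IsPoissonProcess.hasLaw {Ω : Type*} [MeasurableSpace Ω] {N : ℝ≥0 → Ω → ℕ} {r : ℝ≥0}
    {P : Measure Ω} (hN : IsPoissonProcess N r P) (t : ℝ≥0) :
    HasLaw (N t) (poissonMeasure (r * t)) P := by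
  have h := hN.law 0 t zero_le
  rw [tsub_zero] at h
  refine h.congr ?_
  filter_upwards [hN.zero] with ω hω
  simp [hω]

/-- A Poisson process of rate `1` is almost surely unbounded. -/
theorem IsPoissonProcess.ae_exists_le {Ω : Type*} [MeasurableSpace Ω] {N : ℝ≥0 → Ω → ℕ}
    {P : Measure Ω} (hN : IsPoissonProcess N 1 P) : ∀ᵐ ω ∂P, ∀ k, ∃ u, k ≤ N u ω := by
  refine ae_all_iff.2 fun k => ?_
  rw [ae_iff]
  refine le_antisymm (ge_of_tendsto (tendsto_poissonMeasure_natCast_Iic k)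
    (Eventually.of_forall fun m => ?_)) zero_le
  have h := (hN.hasLaw m).measure_eq (p := fun j => j ≤ k) (MeasurableSet.of_discrete)
  rw [one_mul] at h
  refine (measure_mono fun ω hω => ?_).trans h.le
  by_contra hlt
  exact hω ⟨m, (not_le.1 hlt).le⟩

/-! ### Independence -/

/-- If `X`, `Y` are independent and jointly independent of `Z`, then `X` is independent of
`(Y, Z)`. -/
theorem indepFun_prodMk_right {Ω α β δ : Type*} [MeasurableSpace Ω] [MeasurableSpace α]
    [MeasurableSpace β] [MeasurableSpace δ] {P : Measure Ω} [IsProbabilityMeasure P] {X : Ω → α}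
    {Y : Ω → β} {Z : Ω → δ} (hX : Measurable X) (hY : Measurable Y) (hZ : Measurable Z)
    (hXY : IndepFun X Y P) (h : IndepFun (fun ω => (X ω, Y ω)) Z P) :
    IndepFun X (fun ω => (Y ω, Z ω)) P := by
  have hYZ : IndepFun Y Z P := h.comp measurable_snd measurable_id
  rw [indepFun_iff_map_prod_eq_prod_map_map hX.aemeasurable (hY.prodMk hZ).aemeasurable,
    (indepFun_iff_map_prod_eq_prod_map_map hY.aemeasurable hZ.aemeasurable).1 hYZ,
    ← Measure.prodAssoc_prod,
    ← (indepFun_iff_map_prod_eq_prod_map_map hX.aemeasurable hY.aemeasurable).1 hXY,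
    ← (indepFun_iff_map_prod_eq_prod_map_map (hX.prodMk hY).aemeasurable hZ.aemeasurable).1 h,
    Measure.map_map MeasurableEquiv.prodAssoc.measurable ((hX.prodMk hY).prodMk hZ)]
  rfl

/-- One variable of an independent family is independent of the family in which it is replaced by
a constant. -/
theorem indepFun_update {Ω ι α : Type*} [MeasurableSpace Ω] [DecidableEq ι] [MeasurableSpace α]
    {P : Measure Ω} {X : ι → Ω → α} (hX : ∀ i, Measurable (X i)) (h : iIndepFun X P) (i : ι)
    (c : α) : IndepFun (X i) (fun ω => Function.update (fun j => X j ω) i c) P := by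
  have hind := indep_iSup_of_disjoint (fun j => (hX j).comap_le) h.iIndep
    (disjoint_compl_right (a := ({i} : Set ι)))
  rw [IndepFun_iff_Indep]
  refine indep_of_indep_of_le_left (indep_of_indep_of_le_right hind ?_) ?_
  · refine Measurable.comap_le ?_
    refine @measurable_pi_lambda _ _ _ (_) _ _ fun j => ?_
    by_cases hj : j = i
    · subst hj
      simp only [Function.update_self]
      exact measurable_const
    · simp only [Function.update_of_ne hj]
      exact Measurable.of_comap_le (le_iSup₂_of_le j hj le_rfl)
  · exact le_iSup₂_of_le i rfl le_rfl

/-- A real random variable with a density avoids a random null set that is independent of it. -/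
theorem ae_prodMk_notMem_of_indepFun {Ω β : Type*} [MeasurableSpace Ω] [MeasurableSpace β]
    {P : Measure Ω} [IsProbabilityMeasure P] {X : Ω → ℝ} {Y : Ω → β} (hX : Measurable X)
    (hY : Measurable Y) (hYX : IndepFun Y X P) (hac : P.map X ≪ volume) {M : Set (β × ℝ)}
    (hM : MeasurableSet M) (h : ∀ᵐ ω ∂P, volume {r | (Y ω, r) ∈ M} = 0) :
    ∀ᵐ ω ∂P, (Y ω, X ω) ∉ M := by
  have hprod := (indepFun_iff_map_prod_eq_prod_map_map hY.aemeasurable hX.aemeasurable).1 hYX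
  have : IsProbabilityMeasure (P.map X) := Measure.isProbabilityMeasure_map hX.aemeasurable
  have hnull : P.map (fun ω => (Y ω, X ω)) M = 0 := by
    rw [hprod, Measure.measure_prod_null hM]
    refine (ae_map_iff hY.aemeasurable
      (measurableSet_eq_fun (measurable_measure_prodMk_left hM) measurable_const)).2 ?_
    filter_upwards [h] with ω hω
    exact hac hω
  rw [Measure.map_apply (hY.prodMk hX) hM] at hnull
  exact measure_eq_zero_iff_ae_notMem.1 hnull

/-! ### Almost sure properties of the clock -/

section Driving

variable {Ω : Type*} [MeasurableSpace Ω] {P : Measure Ω} {γ : ℕ+ → ℝ≥0}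
  {N : ℕ+ → ℝ≥0 → Ω → ℕ} {T₀ : Ω → ℝ} {T : ℕ+ → ℕ → Ω → ℝ}

/-- A random finite sum as a series with indicator weights, so that the upper limit becomes an
integrand. -/
theorem sum_range_eq_tsum_ite_mul (k : ℕ) (w : ℕ → ℝ≥0∞) :
    ∑ i ∈ Finset.range k, w i = ∑' i, (if i < k then 1 else 0) * w i := by
  rw [tsum_eq_sum (s := Finset.range k) fun i hi => by simp [Finset.mem_range.not.1 hi]]
  exact Finset.sum_congr rfl fun i hi => by simp [Finset.mem_range.1 hi]

/-- Wald's identity for the compound Poisson sums in the clock. -/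
theorem IsDriving.lintegral_sum (h : IsDriving N T₀ T P) (x : ℕ+) (u : ℝ≥0) :
    ∫⁻ ω, ∑ i ∈ Finset.range (N x u ω), ENNReal.ofReal (T x i ω) ∂P =
      (∫⁻ k : ℕ, (k : ℝ≥0∞) ∂poissonMeasure (1 * u)) * ∫⁻ r, ENNReal.ofReal r ∂expMeasure 1 := by
  have hN : ∀ i, Measurable fun ω => if i < N x u ω then (1 : ℝ≥0∞) else 0 := fun i =>
    (measurable_of_countable fun k : ℕ => if i < k then (1 : ℝ≥0∞) else 0).comp
      ((h.poisson x).measurable u)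
  have hT : ∀ i, Measurable fun ω => ENNReal.ofReal (T x i ω) := fun i =>
    (h.measT x i).ennreal_ofReal
  have hone : ∀ k : ℕ, ∑' i, (if i < k then (1 : ℝ≥0∞) else 0) = k := by
    intro k
    have := sum_range_eq_tsum_ite_mul k fun _ => 1
    simpa using this.symm
  have hNT : ∀ i, AEMeasurable
      (fun ω => (if i < N x u ω then 1 else 0) * ENNReal.ofReal (T x i ω)) P := fun i =>
    ((hN i).mul (hT i)).aemeasurable
  simp only [sum_range_eq_tsum_ite_mul]
  rw [lintegral_tsum hNT,
    ← ((h.poisson x).hasLaw u).lintegral_comp (measurable_of_countable _).aemeasurable]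
  simp only [← hone]
  rw [lintegral_tsum fun i => (hN i).aemeasurable, ← ENNReal.tsum_mul_right]
  refine tsum_congr fun i => ?_
  rw [← (h.lawT x i).lintegral_comp ENNReal.measurable_ofReal.aemeasurable]
  have hind : IndepFun (fun ω => if i < N x u ω then (1 : ℝ≥0∞) else 0)
      (fun ω => ENNReal.ofReal (T x i ω)) P := by
    refine h.indepNT.comp
      (φ := fun n : ℕ+ → ℝ≥0 → ℕ => if i < n x u then (1 : ℝ≥0∞) else 0)
      (ψ := fun f : Option (ℕ+ × ℕ) → ℝ => ENNReal.ofReal (f (some (x, i)))) ?_ ?_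
    · exact (measurable_of_countable fun k : ℕ => if i < k then (1 : ℝ≥0∞) else 0).comp
        ((measurable_pi_apply u).comp (measurable_pi_apply x))
    · exact (measurable_pi_apply _).ennreal_ofReal
  exact lintegral_mul_eq_lintegral_mul_lintegral_of_indepFun (hN i) (hT i) hind

theorem measurable_clock (hN : ∀ x t, Measurable (N x t)) (hT₀ : Measurable T₀)
    (hT : ∀ x i, Measurable (T x i)) (y : OnePoint ℕ+) (u : ℝ≥0) :
    Measurable (clock γ 0 N T₀ T y u) := by
  unfold clock
  simp only [sum_range_eq_tsum_ite_mul]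
  refine Measurable.add (Measurable.add ?_ (Measurable.tsum fun x => Measurable.const_mul
    (Measurable.tsum fun i => Measurable.mul ?_ (hT x i).ennreal_ofReal) _)) measurable_const
  · exact hT₀.ennreal_ofReal.const_mul _
  · exact (measurable_of_countable fun k : ℕ => if i < k then (1 : ℝ≥0∞) else 0).comp (hN x u)

theorem IsDriving.ae_mono (h : IsDriving N T₀ T P) :
    ∀ᵐ ω ∂P, ∀ x, Monotone fun u => N x u ω :=
  ae_all_iff.2 fun x => (h.poisson x).mono

/-- The clock is almost surely finite: its mean is finite, as `γ` is summable. -/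
theorem IsDriving.ae_clock_ne_top (h : IsDriving N T₀ T P) (hγ : Summable γ) (y : OnePoint ℕ+) :
    ∀ᵐ ω ∂P, ∀ u, clock γ 0 N T₀ T y u ω ≠ ∞ := by
  have hnat : ∀ᵐ ω ∂P, ∀ U : ℕ, clock γ 0 N T₀ T y U ω ≠ ∞ := by
    refine ae_all_iff.2 fun U => ?_
    refine (ae_lt_top (measurable_clock (fun x => (h.poisson x).measurable) h.measT₀ h.measT y _)
      ?_).mono fun ω hω => hω.ne
    have hsum : ∀ x, Measurable fun ω =>
        ∑ i ∈ Finset.range (N x U ω), ENNReal.ofReal (T x i ω) := by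
      intro x
      simp only [sum_range_eq_tsum_ite_mul]
      exact Measurable.tsum fun i => Measurable.mul
        ((measurable_of_countable fun k : ℕ => if i < k then (1 : ℝ≥0∞) else 0).comp
          ((h.poisson x).measurable U)) (h.measT x i).ennreal_ofReal
    simp only [clock_zero_eq_pathClock, pathClock]
    rw [lintegral_add_left (h.measT₀.ennreal_ofReal.const_mul _),
      lintegral_const_mul _ h.measT₀.ennreal_ofReal,
      h.lawT₀.lintegral_comp ENNReal.measurable_ofReal.aemeasurable,
      lintegral_tsum fun x => ((hsum x).const_mul _).aemeasurable]
    simp only [lintegral_const_mul _ (hsum _), h.lintegral_sum]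
    rw [ENNReal.tsum_mul_right]
    exact ENNReal.add_ne_top.2 ⟨ENNReal.mul_ne_top ENNReal.coe_ne_top
      lintegral_ofReal_expMeasure_one_ne_top, ENNReal.mul_ne_top
        (ENNReal.tsum_coe_ne_top_iff_summable.2 hγ)
        (ENNReal.mul_ne_top (lintegral_natCast_poissonMeasure_ne_top _)
          lintegral_ofReal_expMeasure_one_ne_top)⟩
  filter_upwards [hnat, h.ae_mono] with ω hω hmono u
  obtain ⟨U, hU⟩ := exists_nat_ge u
  refine ne_top_of_le_ne_top (hω U) ?_
  rw [clock_zero_eq_pathClock, clock_zero_eq_pathClock]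
  exact pathClock_mono hmono hU

/-- By the second Borel–Cantelli lemma, infinitely many holding times at `x` exceed `1`. -/
theorem IsDriving.ae_tsum_eq_top (h : IsDriving N T₀ T P) (x : ℕ+) :
    ∀ᵐ ω ∂P, ∑' i, ENNReal.ofReal (T x i ω) = ∞ := by
  have hP : IsProbabilityMeasure P := h.indepT.isProbabilityMeasure
  have hmeas : ∀ i, MeasurableSet {ω | 1 < T x i ω} := fun i =>
    measurableSet_lt measurable_const (h.measT x i)
  have hind : iIndepSet (fun i => {ω | 1 < T x i ω}) P := by
    have h1 : iIndepFun (fun i : ℕ => T x i) P :=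
      h.indepT.precomp (g := fun i : ℕ => some (x, i)) fun i j hij => by simpa using hij
    rw [iIndepSet_iff_meas_biInter hmeas]
    exact fun s => h1.measure_inter_preimage_eq_mul s fun i _ => measurableSet_Ioi
  have hlim : P (limsup (fun i => {ω | 1 < T x i ω}) atTop) = 1 := by
    refine measure_limsup_eq_one hmeas hind ?_
    have hlaw : ∀ i, P {ω | 1 < T x i ω} = expMeasure 1 (Ioi 1) := fun i =>
      (h.lawT x i).measure_eq measurableSet_Ioi
    simp only [hlaw]
    exact ENNReal.tsum_const_eq_top_of_ne_zero expMeasure_one_Ioi_one_ne_zero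
  have hae := (mem_ae_iff_prob_eq_one (MeasurableSet.measurableSet_limsup hmeas)).2 hlim
  filter_upwards [hae] with ω hω
  by_contra hne
  rw [mem_limsup_iff_frequently_mem] at hω
  refine hω ?_
  filter_upwards [(ENNReal.tendsto_atTop_zero_of_tsum_ne_top hne).eventually
    (gt_mem_nhds zero_lt_one)] with i hi hlt
  exact absurd hi (not_lt.2 (by
    rw [← ENNReal.ofReal_one]
    exact ENNReal.ofReal_le_ofReal (le_of_lt hlt)))

/-- The clock is almost surely unbounded. -/
theorem IsDriving.ae_exists_lt_clock (h : IsDriving N T₀ T P) (hγ : ∀ x, 0 < γ x)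
    (y : OnePoint ℕ+) (t : ℝ≥0) : ∀ᵐ ω ∂P, ∃ u, t < clock γ 0 N T₀ T y u ω := by
  filter_upwards [h.ae_tsum_eq_top 1, (h.poisson 1).ae_exists_le] with ω hω hN
  have hlim := ENNReal.tendsto_nat_tsum fun i => ENNReal.ofReal (T 1 i ω)
  rw [hω] at hlim
  obtain ⟨k, hk⟩ := (hlim.eventually (lt_mem_nhds
    (ENNReal.div_lt_top (ENNReal.coe_ne_top (r := t))
      (ENNReal.coe_ne_zero.2 (hγ 1).ne')))).exists
  obtain ⟨u, hu⟩ := hN k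
  refine ⟨u, ?_⟩
  rw [clock_zero_eq_pathClock, pathClock]
  rw [ENNReal.div_lt_iff (Or.inl (ENNReal.coe_ne_zero.2 (hγ 1).ne'))
    (Or.inl ENNReal.coe_ne_top), mul_comm] at hk
  refine hk.trans_le (le_trans ?_ (le_add_left (ENNReal.le_tsum (1 : ℕ+))))
  exact mul_le_mul_right (Finset.sum_le_sum_of_subset (Finset.range_subset_range.2 hu)) _

/-! ### Removing the first holding time at a site -/

/-- After the first event of `n x`, the first holding time at `x` contributes a fixed summand to the
clock. -/
theorem pathClock_eq_add_of_pos {a : ℝ≥0∞} {n : ℕ+ → ℝ≥0 → ℕ} {w w' : ℕ+ → ℕ → ℝ≥0∞} {x : ℕ+}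
    (hw : ∀ z i, w z i = (if (z, i) = (x, 0) then w x 0 else 0) + w' z i) {u : ℝ≥0}
    (hu : 0 < n x u) : pathClock γ a n w u = γ x * w x 0 + pathClock γ a n w' u := by
  have hsplit : ∀ z, (γ z : ℝ≥0∞) * ∑ i ∈ Finset.range (n z u), w z i =
      γ z * ∑ i ∈ Finset.range (n z u), (if (z, i) = (x, 0) then w x 0 else 0) +
        γ z * ∑ i ∈ Finset.range (n z u), w' z i := by
    intro z
    rw [← mul_add, ← Finset.sum_add_distrib]
    simp only [← hw]
  have hsite : ∑' z, (γ z : ℝ≥0∞) *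
      ∑ i ∈ Finset.range (n z u), (if (z, i) = (x, 0) then w x 0 else 0) = γ x * w x 0 := by
    rw [tsum_eq_single x fun z hz => by simp [hz],
      Finset.sum_eq_single_of_mem 0 (Finset.mem_range.2 hu) fun i _ hi => by simp [hi]]
    simp
  rw [pathClock, tsum_congr hsplit, ENNReal.tsum_add, hsite, pathClock, add_left_comm]

/-- A fixed time `t` is almost surely not a limit of values of the clock taken after the first event
of `N x`: given all the other variables, such values of the clock form the translate by
`γ x * T x 0` of a null set, and `T x 0` has a density. -/
theorem IsDriving.ae_notMem_closure_clock (h : IsDriving N T₀ T P) (hγ_pos : ∀ x, 0 < γ x)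
    (hγ : Summable γ) (y : OnePoint ℕ+) (t : ℝ≥0) (q : ℕ → ℝ≥0) (x : ℕ+) (U : ℕ) :
    ∀ᵐ ω ∂P, (t : ℝ) ∉ closure ((fun u => (clock γ 0 N T₀ T y u ω).toReal) ''
      {u | u ∈ range q ∧ u ≤ U ∧ 0 < N x u ω}) := by
  have hP : IsProbabilityMeasure P := h.indepT.isProbabilityMeasure
  set X : Option (ℕ+ × ℕ) → Ω → ℝ := fun k => k.elim T₀ fun p => T p.1 p.2
  have hXmeas : ∀ k, Measurable (X k) := by
    rintro (_ | p)
    · exact h.measT₀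
    · exact h.measT p.1 p.2
  -- All the variables but `T x 0`, which is replaced by `0`
  set Y : Ω → (Option (ℕ+ × ℕ) → ℝ) × (ℕ+ → ℝ≥0 → ℕ) :=
    fun ω => (Function.update (fun k => X k ω) (some (x, 0)) 0, fun z u => N z u ω) with hY
  have hY1 : Measurable fun ω => Function.update (fun k => X k ω) (some (x, 0)) 0 := by
    refine measurable_pi_lambda _ fun k => ?_
    by_cases hk : k = some (x, 0)
    · simp [hk]
    · simpa [Function.update_of_ne hk] using hXmeas k
  have hY2 : Measurable fun ω z u => N z u ω :=
    measurable_pi_lambda _ fun z => measurable_pi_lambda _ fun u => (h.poisson z).measurable u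
  have hind : IndepFun Y (T x 0) P := by
    refine (indepFun_prodMk_right (h.measT x 0) hY1 hY2
      (indepFun_update hXmeas h.indepT (some (x, 0)) 0) ?_).symm
    have hXind : IndepFun (fun ω k => X k ω) (fun ω z u => N z u ω) P := by
      convert h.indepNT.symm using 3 with ω k
      rcases k with _ | p <;> rfl
    refine hXind.comp (φ := fun f : Option (ℕ+ × ℕ) → ℝ =>
      (f (some (x, 0)), Function.update f (some (x, 0)) 0)) ?_ measurable_id
    refine (measurable_pi_apply _).prodMk (measurable_pi_lambda _ fun k => ?_)
    by_cases hk : k = some (x, 0)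
    · simp [hk]
    · simpa [Function.update_of_ne hk] using measurable_pi_apply k
  -- The clock driven by a point of the range of `Y`
  set G : ℝ≥0 → (Option (ℕ+ × ℕ) → ℝ) × (ℕ+ → ℝ≥0 → ℕ) → ℝ≥0∞ :=
    clock γ 0 (fun z u p => p.2 z u) (fun p => p.1 none) (fun z i p => p.1 (some (z, i))) y with hG
  have hGmeas : ∀ u, Measurable (G u) := fun u => measurable_clock
    (fun z s => (measurable_pi_apply s).comp ((measurable_pi_apply z).comp measurable_snd))
    ((measurable_pi_apply _).comp measurable_fst)
    (fun z i => (measurable_pi_apply _).comp measurable_fst) y u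
  set C : (Option (ℕ+ × ℕ) → ℝ) × (ℕ+ → ℝ≥0 → ℕ) → Set ℝ := fun p =>
    closure ((fun u => (G u p).toReal) '' {u | u ∈ range q ∧ u ≤ U ∧ 0 < p.2 x u}) with hC
  set M : Set (((Option (ℕ+ × ℕ) → ℝ) × (ℕ+ → ℝ≥0 → ℕ)) × ℝ) :=
    {z | (t : ℝ) - γ x * z.2 ∈ C z.1} with hM
  have hMmeas : MeasurableSet M := by
    have hM' : M = ⋂ m : ℕ, ⋃ k : ℕ, {z | (q k ≤ U ∧ 0 < z.1.2 x (q k)) ∧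
        dist ((t : ℝ) - γ x * z.2) (G (q k) z.1).toReal < 1 / ((m : ℝ) + 1)} := by
      ext z
      simp only [hM, hC, mem_ofPred_eq, mem_iInter, mem_iUnion, Metric.mem_closure_iff]
      constructor
      · intro hz m
        obtain ⟨_, ⟨_, ⟨⟨k, rfl⟩, hk⟩, rfl⟩, hd⟩ := hz _ (Nat.one_div_pos_of_nat (n := m))
        exact ⟨k, hk, hd⟩
      · intro hz ε hε
        obtain ⟨m, hm⟩ := exists_nat_one_div_lt hε
        obtain ⟨k, hk, hd⟩ := hz m
        exact ⟨_, ⟨_, ⟨⟨k, rfl⟩, hk⟩, rfl⟩, hd.trans hm⟩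
    rw [hM']
    refine MeasurableSet.iInter fun m => MeasurableSet.iUnion fun k => MeasurableSet.inter
      (MeasurableSet.inter (MeasurableSet.const _) ?_) ?_
    · have hx : Measurable fun z : ((Option (ℕ+ × ℕ) → ℝ) × (ℕ+ → ℝ≥0 → ℕ)) × ℝ =>
          z.1.2 x (q k) := by fun_prop
      exact measurableSet_lt measurable_const hx
    · refine measurableSet_lt (Measurable.dist ?_ ?_) measurable_const
      · exact measurable_const.sub (measurable_snd.const_mul _)
      · exact ((hGmeas _).comp measurable_fst).ennreal_toReal
  -- Replacing `T x 0` by `0` removes the first holding time at `x` and changes no other.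
  have hw : ∀ ω (z : ℕ+) (i : ℕ), ENNReal.ofReal (T z i ω) =
      (if (z, i) = (x, 0) then ENNReal.ofReal (T x 0 ω) else 0) +
        ENNReal.ofReal ((Y ω).1 (some (z, i))) := by
    intro ω z i
    by_cases hzi : (z, i) = (x, 0)
    · obtain ⟨rfl, rfl⟩ := Prod.mk.injEq .. ▸ hzi
      simp [hY]
    · have : some (z, i) ≠ some (x, 0) := fun hh => hzi (Option.some_injective _ hh)
      simp only [if_neg hzi, zero_add, hY, Function.update_of_ne this]
      rfl
  have hclock : ∀ ω u, clock γ 0 N T₀ T y u ω = pathClock γ (extend γ y * ENNReal.ofReal (T₀ ω))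
      (fun z s => N z s ω) (fun z i => ENNReal.ofReal (T z i ω)) u := fun ω u =>
    clock_zero_eq_pathClock ..
  have hGY : ∀ ω u, G u (Y ω) = pathClock γ (extend γ y * ENNReal.ofReal (T₀ ω))
      (fun z s => N z s ω) (fun z i => ENNReal.ofReal ((Y ω).1 (some (z, i)))) u := fun ω u => by
    rw [hG, clock_zero_eq_pathClock]
    rfl
  have hGle : ∀ ω u, G u (Y ω) ≤ clock γ 0 N T₀ T y u ω := fun ω u => by
    rw [hclock, hGY]
    refine add_le_add le_rfl (ENNReal.tsum_le_tsum fun z => mul_le_mul_right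
      (Finset.sum_le_sum fun i _ => ?_) _)
    change ENNReal.ofReal ((Y ω).1 (some (z, i))) ≤ ENNReal.ofReal (T z i ω)
    rw [hw ω z i]
    exact le_add_self
  have hnull : ∀ᵐ ω ∂P, volume {r | (Y ω, r) ∈ M} = 0 := by
    filter_upwards [h.ae_mono, h.ae_clock_ne_top hγ y] with ω hmono hfin
    have hC0 : volume (C (Y ω)) = 0 := by
      have hfinG := ne_top_of_le_ne_top (hfin U) (hGle ω U)
      simp only [hC, hGY] at hfinG ⊢
      exact volume_closure_image_pathClock hmono hfinG fun u hu => hu.2.1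
    have hpre : {r | (Y ω, r) ∈ M} = (fun r => (γ x : ℝ) * r) ⁻¹' ((fun r => (t : ℝ) - r) ⁻¹'
        C (Y ω)) := rfl
    have hγx : (γ x : ℝ) ≠ 0 := NNReal.coe_ne_zero.2 (hγ_pos x).ne'
    rw [hpre, Real.volume_preimage_mul_left hγx,
      (Measure.measurePreserving_sub_left volume (t : ℝ)).measure_preimage
        isClosed_closure.measurableSet.nullMeasurableSet, hC0, mul_zero]
  have hac : P.map (T x 0) ≪ volume := by
    rw [(h.lawT x 0).map_eq]
    exact expMeasure_one_absolutelyContinuous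
  filter_upwards [ae_prodMk_notMem_of_indepFun (h.measT x 0) (hY1.prodMk hY2) hind hac hMmeas hnull,
    h.ae_clock_ne_top hγ y,
    ((h.lawT x 0).ae_iff (measurableSet_setOfPred.1 measurableSet_Ici)).2
      ae_nonneg_expMeasure_one] with ω hω hfin hT0 hmem
  refine hω ?_
  -- After the first event at `x`, the clock is the residual clock translated by `γ x * T x 0`
  have himage : (fun u => (clock γ 0 N T₀ T y u ω).toReal) ''
      {u | u ∈ range q ∧ u ≤ U ∧ 0 < N x u ω} ⊆
        (fun r => (t : ℝ) - (t - γ x * T x 0 ω) + r) '' ((fun u => (G u (Y ω)).toReal) ''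
          {u | u ∈ range q ∧ u ≤ U ∧ 0 < N x u ω}) := by
    rintro _ ⟨u, hu, rfl⟩
    refine ⟨_, ⟨u, hu, rfl⟩, ?_⟩
    have hsplit : clock γ 0 N T₀ T y u ω = γ x * ENNReal.ofReal (T x 0 ω) + G u (Y ω) := by
      rw [hclock, hGY]
      exact pathClock_eq_add_of_pos (hw ω) hu.2.2
    have hfinG := ne_top_of_le_ne_top (hfin u) (hGle ω u)
    simp only [hsplit]
    rw [ENNReal.toReal_add (ENNReal.mul_ne_top ENNReal.coe_ne_top ENNReal.ofReal_ne_top) hfinG,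
      ENNReal.toReal_mul, ENNReal.toReal_ofReal hT0, ENNReal.coe_toReal]
    ring
  have hmem' := closure_mono himage hmem
  have hhom := (Homeomorph.addLeft ((t : ℝ) - (t - γ x * T x 0 ω))).image_closure
    ((fun u => (G u (Y ω)).toReal) '' {u | u ∈ range q ∧ u ≤ U ∧ 0 < N x u ω})
  rw [Homeomorph.coe_addLeft] at hhom
  rw [← hhom] at hmem'
  obtain ⟨r, hr, hrt⟩ := hmem'
  have hr' : r = t - γ x * T x 0 ω := by linarith
  rw [hr'] at hr
  exact hr

/-- The initial holding time almost surely does not end exactly at a given `t > 0`. -/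
theorem IsDriving.ae_initial_ne (h : IsDriving N T₀ T P)
    (y : OnePoint ℕ+) {t : ℝ≥0} (ht : 0 < t) :
    ∀ᵐ ω ∂P, (extend γ y : ℝ≥0∞) * ENNReal.ofReal (T₀ ω) ≠ t := by
  -- If `extend γ y = 0`, the excluded value is the junk value `0`; the claim then holds because
  -- `t ≠ 0`.
  have hne : ∀ᵐ r : ℝ ∂expMeasure 1, r ≠ (t : ℝ) / (extend γ y : ℝ) :=
    expMeasure_one_absolutelyContinuous.ae_le (Measure.ae_ne volume _)
  filter_upwards [(h.lawT₀.ae_iff (measurableSet_setOfPred.1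
    (measurableSet_singleton _).compl)).2 hne] with ω hω heq
  have hreal := congrArg ENNReal.toReal heq
  rw [ENNReal.toReal_mul, ENNReal.coe_toReal, ENNReal.coe_toReal] at hreal
  have htpos : (0 : ℝ) < t := NNReal.coe_pos.2 ht
  rcases le_or_gt (T₀ ω) 0 with h0 | h0
  · rw [ENNReal.ofReal_of_nonpos h0, ENNReal.toReal_zero, mul_zero] at hreal
    exact htpos.ne hreal
  · rw [ENNReal.toReal_ofReal h0.le] at hreal
    have hγy : (extend γ y : ℝ) ≠ 0 := fun h1 => htpos.ne (by rw [← hreal, h1, zero_mul])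
    exact hω (eq_div_of_mul_eq hγy (by rw [mul_comm]; exact hreal))

theorem IsDriving.measure_kProc_eq_infty (h : IsDriving N T₀ T P) (hγ_pos : ∀ x, 0 < γ x)
    (hγ : Summable γ) (y : OnePoint ℕ+) {t : ℝ≥0} (ht : 0 < t) :
    P {ω | kProc γ 0 N T₀ T y t ω = OnePoint.infty} = 0 := by
  refine measure_eq_zero_iff_ae_notMem.2 ?_
  filter_upwards [h.ae_mono, ae_all_iff.2 fun x => (h.poisson x).zero,
    ae_all_iff.2 fun x => (h.poisson x).rightCts, h.ae_clock_ne_top hγ y,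
    h.ae_exists_lt_clock hγ_pos y t, h.ae_initial_ne y ht,
    ae_all_iff.2 fun x => ae_all_iff.2 fun U : ℕ =>
      h.ae_notMem_closure_clock hγ_pos hγ y t (TopologicalSpace.denseSeq ℝ≥0) x U]
    with ω hmono hzero hrc hfin hunb hinit hclos hmem
  change kProc γ 0 N T₀ T y t ω = OnePoint.infty at hmem
  have hnot : ¬ (t : ℝ≥0∞) < (extend γ y : ℝ≥0∞) * ENNReal.ofReal (T₀ ω) := by
    intro hlt
    rw [kProc, if_pos hlt] at hmem
    subst hmem
    simp [extend] at hlt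
  have hsit : ¬ ∃ x, SitsAt γ 0 N T₀ T y t ω x := by
    intro hex
    rw [kProc, if_neg hnot, dif_pos hex] at hmem
    exact OnePoint.coe_ne_infty _ hmem
  have hclock : (fun u => clock γ 0 N T₀ T y u ω) =
      pathClock γ (extend γ y * ENNReal.ofReal (T₀ ω)) (fun z s => N z s ω)
        (fun z i => ENNReal.ofReal (T z i ω)) := funext fun u => clock_zero_eq_pathClock ..
  have hclock' := fun u => congrFun hclock u
  obtain ⟨b, hb⟩ := hunb
  rw [hclock'] at hb
  simp only [hclock'] at hfin hclos
  rcases exists_jump_or_mem_closure hmono hzero hrc hfin (lt_of_le_of_ne (not_lt.1 hnot) hinit)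
    hb (TopologicalSpace.denseRange_denseSeq ℝ≥0) with
    ⟨x, j, hj, s, hs, hle, hlt⟩ | ⟨x, U, hx⟩
  · refine hsit ⟨x, j, hj, s, hs, ?_, ?_⟩
    · rw [hclock]; exact hle
    · rw [hclock']; exact hlt
  · exact hclos x U hx

end Driving

end KProc

/-! ### The process at a fixed time -/

theorem lemma3p4 {Ω : Type*} [MeasurableSpace Ω] (P : Measure Ω) [IsProbabilityMeasure P]
    (γ : ℕ+ → ℝ≥0) (hγ_pos : ∀ x, 0 < γ x) (hγ_sum : Summable γ)
    (N : ℕ+ → ℝ≥0 → Ω → ℕ) (T₀ : Ω → ℝ) (T : ℕ+ → ℕ → Ω → ℝ)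
    (hNT : KProc.IsDriving N T₀ T P) :
    (∀ y : OnePoint ℕ+, ∀ t : ℝ≥0, 0 < t →
      P {ω | KProc.kProc γ 0 N T₀ T y t ω = OnePoint.infty} = 0) ∧
    ¬ KProc.StronglyContinuousAt P (KProc.kProc γ 0 N T₀ T) OnePoint.infty OnePoint.infty := by
  have hzero : ∀ y : OnePoint ℕ+, ∀ t : ℝ≥0, 0 < t →
      P {ω | KProc.kProc γ 0 N T₀ T y t ω = OnePoint.infty} = 0 := fun y t ht =>
    hNT.measure_kProc_eq_infty hγ_pos hγ_sum y ht
  refine ⟨hzero, fun hcont => ?_⟩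
  have hlim : Tendsto (fun _ : ℝ≥0 => (0 : ℝ≥0∞)) (𝓝[>] 0) (𝓝 1) := by
    have h1 := hcont
    rw [KProc.StronglyContinuousAt, indicator_of_mem (mem_singleton _), Pi.one_apply] at h1
    exact h1.congr' (eventually_nhdsWithin_of_forall fun t ht => hzero _ t ht)
  exact zero_ne_one (tendsto_nhds_unique tendsto_const_nhds hlim)
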